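/- Let $d\ge 1$, $k\ge 2$ and $a_1,\dots,a_k\ge 1$ be integers. Let $X$ be the finite set of all tuples $j=(j_{i\ell})_{1\le i\le k,\,0\le \ell\le d}$ of nonnegative integers with $j_{i0}+\dots+j_{id}=a_i$ for every $i$, and let $\Delta_X=\{p\in\mathbb R^X: p_x\ge 0,\ \sum_x p_x=1\}$. The box model $\mathcal B=\mathcal B^{(d)}_{a_1,\dots,a_k}\subset\Delta_X$ is the image of $\Delta_d\times\dots\times\Delta_d$ ($k$ factors, $\Delta_d=\{s\in\mathbb R^{d+1}: s_\ell\ge0,\ \sum_\ell s_\ell=1\}$) under $$(s_1,\dots,s_k)\longmapsto\Big(\prod_{i=1}^k\binom{a_i}{j_{i0},\dots,j_{id}}\,s_{i0}^{j_{i0}}\cdots s_{id}^{j_{id}}\Big)_{j\in X}.$$ Let $A$ be the matrix with rows indexed by the pairs $(i,\ell)$ and columns indexed by $X$, whose column with index $j$ is $(j_{i\ell})_{i,\ell}$. For $p,q\in\Delta_X$ let $D(p\|q)=\sum_x p_x\log(p_x/q_x)$ if $\operatorname{supp}(p)\subseteq\operatorname{supp}(q)$ (with $0\log 0=0\log(0/0)=0$),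 and $D(p\|q)=+\infty$ otherwise. Let $D_{\mathcal B}(p)=\min_{q\in\mathcal B}D(p\|q)$. The logarithmic Voronoi cell of $\mathcal B$ at $q\in\mathcal B$ is the set of all $u\in\Delta_X$ with $D(u\|q)=D_{\mathcal B}(u)$. Then the minimum defining $D_{\mathcal B}(p)$ is attained for every $p\in\Delta_X$, and $$\max_{p\in\Delta_X}D_{\mathcal B}(p)=(a_1+\dots+a_k-1)\log(d+1).$$ Let $b$ be the vector with $b_{i\ell}=\frac{a_i}{d+1}$ for all $i,\ell$, and let $Q_b=\{p\in\Delta_X: Ap=b\}$. There is a point $q\in\mathcal B$ with $Aq=b$ such that $Q_b$ is the logarithmic Voronoi cell of $\mathcal B$ at $q$, and no logarithmic Voronoi cell of $\mathcal B$ at any other point of $\mathcal B$ contains a maximizer of $D_{\mathcal B}$. The set of maximizers of $D_{\mathcal B}$ over $\Delta_X$ consists of exactly $[(d+1)!]^{k-1}$ points, all of which are vertices of $Q_b$. -/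

import Mathlib

noncomputable section

/-- Information (Kullback-Leibler) divergence `D(p ‖ q)` of two probability vectors on a finite set,
with `0 log 0 = 0 log (0 / 0) = 0`, and `D(p ‖ q) = +∞` if the support of `p` is not contained in
the support of `q`. -/
def infoDiv {X : Type*} [Fintype X] (p q : X → ℝ) : EReal :=
  open Classical in
  if Function.support p ⊆ Function.support q then
    ((∑ x, p x * Real.log (p x / q x) : ℝ) : EReal)
  else ⊤

/-- The divergence `D_M(p)` from `p` to the model `M`: the infimum of `D(p ‖ q)` over `q ∈ M`. -/
def divergenceTo {X : Type*} [Fintype X] (M : Set (X → ℝ)) (p : X → ℝ) : EReal :=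
  sInf (infoDiv p '' M)

/-- The maximum divergence `D(M)`: the supremum of `D_M(p)` over the probability simplex. -/
def maxDivergence {X : Type*} [Fintype X] (M : Set (X → ℝ)) : EReal :=
  sSup (divergenceTo M '' stdSimplex ℝ X)

/-- The points of the probability simplex at which `D(M)` is attained. -/
def divergenceMaximizers {X : Type*} [Fintype X] (M : Set (X → ℝ)) : Set (X → ℝ) :=
  {p | p ∈ stdSimplex ℝ X ∧ divergenceTo M p = maxDivergence M}

/-- The logarithmic Voronoi cell of the model `M` at `q`: all points `u` of the probability simplex
such that `q` is a maximum likelihood estimate of `u`, i.e. `q` minimizes `D(u ‖ ·)` over `M`. -/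
def logVoronoiCell {X : Type*} [Fintype X] (M : Set (X → ℝ)) (q : X → ℝ) : Set (X → ℝ) :=
  {u | u ∈ stdSimplex ℝ X ∧ q ∈ M ∧ infoDiv u q = divergenceTo M u}

/-- The polytope `Q_b = {p ∈ Δ : A p = b}`. -/
def fiberPolytope {R X : Type*} [Fintype X] (A : Matrix R X ℝ) (b : R → ℝ) : Set (X → ℝ) :=
  {p | p ∈ stdSimplex ℝ X ∧ A.mulVec p = b}

/-- The states of the box model: tuples `((j_{10}, …, j_{1d}), …, (j_{k0}, …, j_{kd}))` of natural
numbers with `j_{i0} + … + j_{id} = a_i` for every `i`. -/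
abbrev BoxState (d : ℕ) {k : ℕ} (a : Fin k → ℕ) : Type :=
  (i : Fin k) → {j : Fin (d + 1) → ℕ // j ∈ Finset.piAntidiag Finset.univ (a i)}

/-- The parametrization of the box model: the probability of observing exactly `j_{iℓ}` occurrences
of state `ℓ` in group `i`, for every `i` and `ℓ`, if the variables are independent and every one of
the `a_i` variables of group `i` has distribution `s_i`. -/
def boxParam (d : ℕ) {k : ℕ} (a : Fin k → ℕ) (s : Fin k → Fin (d + 1) → ℝ) :
    BoxState d a → ℝ :=
  fun j => ∏ i, ((Nat.multinomial Finset.univ (j i).1 : ℕ) : ℝ) * ∏ l, s i l ^ (j i).1 l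

/-- The box model: the image of `Δ_d × … × Δ_d` under the parametrization. -/
def boxModel (d : ℕ) {k : ℕ} (a : Fin k → ℕ) : Set (BoxState d a → ℝ) :=
  boxParam d a '' {s | ∀ i, s i ∈ stdSimplex ℝ (Fin (d + 1))}

/-- The matrix `A` of the box model: the column of the state `j` is the vector of all `j_{iℓ}`. -/
def boxMatrix (d : ℕ) {k : ℕ} (a : Fin k → ℕ) :
    Matrix (Fin k × Fin (d + 1)) (BoxState d a) ℝ :=
  fun r j => ((j r.1).1 r.2 : ℝ)

/-- The centroid of the convex hull of the columns of `A`: all entries of the `i`-th block are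
`a_i / (d + 1)`. -/
def boxCentroid (d : ℕ) {k : ℕ} (a : Fin k → ℕ) : Fin k × Fin (d + 1) → ℝ :=
  fun r => (a r.1 : ℝ) / ((d : ℝ) + 1)

end

open Finset

/-! Write `θ_i` for `boxMarginal p i`, `H` for entropy and `w` for `boxWeight`. The logarithm of a
model point is `log w` plus a linear function of the counts, so `D(p ‖ q_s) = boxDiv p + ∑ a_i D(θ_i
‖ s_i)`. By Gibbs' inequality the unique best parameter is `s = θ`; hence the minimum is attained
and the logarithmic Voronoi cells are the fibres of `A`.

In `boxDiv p = ∑ p log (p / w) + ∑ a_i H(θ_i)` the first sum is at most `-H(θ_i)` for any one group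
`i` (`sum_mul_log_weight_le`), because `p x / w x ≤ θ_i l` whenever `l` occurs in group `i` of `x`.
One entropy is thus cancelled, and `H ≤ log (d + 1)` bounds the rest.

Equality makes every `θ_j` with `j ≠ i` uniform; since `k ≥ 2` and `i` is free, all are. Then `p = w
/ (d + 1)` on the support, comparison of two groups gives `w = 1`, so each group is constant in a
support state, and no two support states agree in a group. The support is therefore the graph of a
tuple of permutations, determined up to a common relabelling: `((d + 1)!) ^ (k - 1)` choices. -/

/-! ### Gibbs' inequality and its equality case -/

theorem klSum_nonneg {ι : Type*} [Fintype ι] {s t : ι → ℝ} (hs : s ∈ stdSimplex ℝ ι)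
    (ht : t ∈ stdSimplex ℝ ι) (hst : ∀ i, s i ≠ 0 → t i ≠ 0) :
    0 ≤ ∑ i, s i * (Real.log (s i) - Real.log (t i)) := by
  have h : ∀ i, s i - t i ≤ s i * (Real.log (s i) - Real.log (t i)) := by
    intro i
    rcases (hs.1 i).eq_or_lt with h0 | h0
    · simp [← h0, ht.1 i]
    · have ht0 : 0 < t i := lt_of_le_of_ne (ht.1 i) (Ne.symm (hst i h0.ne'))
      have := Real.log_le_sub_one_of_pos (div_pos ht0 h0)
      rw [Real.log_div ht0.ne' h0.ne'] at this
      have h2 := mul_le_mul_of_nonneg_left this h0.le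
      have h3 : s i * (t i / s i - 1) = t i - s i := by field_simp
      linarith
  calc (0 : ℝ) = ∑ i, (s i - t i) := by rw [sum_sub_distrib, hs.2, ht.2, sub_self]
    _ ≤ _ := sum_le_sum fun i _ => h i

/-- The terms dominate `s i - t i`, whose sum is also zero, so each of the inequalities is an
equality; `log x < x - 1` for `x ≠ 1` then forces `t i = s i`. -/
theorem eq_of_klSum_eq_zero {ι : Type*} [Fintype ι] {s t : ι → ℝ} (hs : s ∈ stdSimplex ℝ ι)
    (ht : t ∈ stdSimplex ℝ ι) (hst : ∀ i, s i ≠ 0 → t i ≠ 0)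
    (h0 : ∑ i, s i * (Real.log (s i) - Real.log (t i)) = 0) : s = t := by
  have h : ∀ i, s i - t i ≤ s i * (Real.log (s i) - Real.log (t i)) ∧
      (s i * (Real.log (s i) - Real.log (t i)) = s i - t i → s i = t i) := by
    intro i
    rcases (hs.1 i).eq_or_lt with h0 | h0
    · simpa [← h0, ht.1 i] using Eq.symm
    · have ht0 : 0 < t i := lt_of_le_of_ne (ht.1 i) (Ne.symm (hst i h0.ne'))
      have h3 : s i * (t i / s i - 1) = t i - s i := by field_simp
      have h4 : Real.log (t i / s i) = Real.log (t i) - Real.log (s i) :=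
        Real.log_div ht0.ne' h0.ne'
      refine ⟨?_, fun he => ?_⟩
      · have := Real.log_le_sub_one_of_pos (div_pos ht0 h0)
        have h2 := mul_le_mul_of_nonneg_left this h0.le
        rw [h4] at h2
        linarith
      · by_contra hne
        have hne' : t i / s i ≠ 1 := fun h => hne ((div_eq_one_iff_eq h0.ne').1 h).symm
        have := Real.log_lt_sub_one_of_pos (div_pos ht0 h0) hne'
        have h2 := mul_lt_mul_of_pos_left this h0
        rw [h4] at h2
        linarith
  have hsum : ∑ i, (s i - t i) = ∑ i, s i * (Real.log (s i) - Real.log (t i)) := by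
    rw [h0, sum_sub_distrib, hs.2, ht.2, sub_self]
  have := (sum_eq_sum_iff_of_le fun i _ => (h i).1).1 hsum
  exact funext fun i => (h i).2 (this i (mem_univ i)).symm

theorem const_mem_stdSimplex (d : ℕ) :
    (fun _ => 1 / ((d : ℝ) + 1)) ∈ stdSimplex ℝ (Fin (d + 1)) := by
  refine ⟨fun _ => by positivity, ?_⟩
  simp only [sum_const, card_univ, Fintype.card_fin, nsmul_eq_mul, Nat.cast_add, Nat.cast_one]
  field_simp

theorem klSum_const (d : ℕ) {s : Fin (d + 1) → ℝ} (hs : s ∈ stdSimplex ℝ (Fin (d + 1))) :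
    ∑ l, s l * (Real.log (s l) - Real.log (1 / ((d : ℝ) + 1))) =
      ∑ l, s l * Real.log (s l) + Real.log ((d : ℝ) + 1) := by
  simp only [one_div, Real.log_inv, sub_neg_eq_add, mul_add, sum_add_distrib, ← sum_mul, hs.2,
    one_mul]

theorem neg_log_le_sum_mul_log (d : ℕ) {s : Fin (d + 1) → ℝ}
    (hs : s ∈ stdSimplex ℝ (Fin (d + 1))) :
    -Real.log ((d : ℝ) + 1) ≤ ∑ l, s l * Real.log (s l) := by
  have := klSum_nonneg hs (const_mem_stdSimplex d) fun _ _ => by positivity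
  rw [klSum_const d hs] at this
  linarith

theorem eq_const_of_sum_mul_log_eq (d : ℕ) {s : Fin (d + 1) → ℝ}
    (hs : s ∈ stdSimplex ℝ (Fin (d + 1)))
    (h : ∑ l, s l * Real.log (s l) = -Real.log ((d : ℝ) + 1)) :
    s = fun _ => 1 / ((d : ℝ) + 1) := by
  refine eq_of_klSum_eq_zero hs (const_mem_stdSimplex d) (fun _ _ => by positivity) ?_
  rw [klSum_const d hs, h, neg_add_cancel]

/-! ### Multinomial coefficients -/

/-- The multinomial coefficient is a multiple of `n.choose (f l)`, and `n.choose (f l) * f l = n *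
(n - 1).choose (f l - 1)`. -/
theorem le_multinomial_mul {ι : Type*} [Fintype ι] [DecidableEq ι] {n : ℕ} {f : ι → ℕ}
    (hf : ∑ i, f i = n) {l : ι} (hl : f l ≠ 0) : n ≤ Nat.multinomial univ f * f l := by
  have h1 : Nat.multinomial univ f
      = (f l + ∑ i ∈ univ.erase l, f i).choose (f l) * Nat.multinomial (univ.erase l) f := by
    rw [← Nat.multinomial_insert (notMem_erase l univ), insert_erase (mem_univ l)]
  have h2 : f l + ∑ i ∈ univ.erase l, f i = n := by rw [add_sum_erase _ _ (mem_univ l), hf]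
  rw [h2] at h1
  obtain ⟨j, hj⟩ := Nat.exists_eq_succ_of_ne_zero hl
  obtain ⟨m, rfl⟩ : ∃ m, n = m + 1 := ⟨n - 1, by omega⟩
  have h3 := Nat.add_one_mul_choose_eq m j
  have h4 : 0 < m.choose j := Nat.choose_pos (by omega)
  have h5 : 0 < Nat.multinomial (univ.erase l) f := Nat.multinomial_pos _ _
  rw [h1, hj]
  calc m + 1 ≤ (m + 1) * m.choose j := Nat.le_mul_of_pos_right _ h4
    _ = (m + 1).choose (j + 1) * (j + 1) := h3
    _ ≤ _ := by
      rw [mul_right_comm]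
      exact Nat.le_mul_of_pos_right _ h5

theorem multinomial_single {ι : Type*} [Fintype ι] [DecidableEq ι] (l : ι) (n : ℕ) :
    Nat.multinomial univ (Pi.single l n : ι → ℕ) = 1 := by
  have h := Nat.multinomial_spec univ (Pi.single l n : ι → ℕ)
  rw [Finset.sum_pi_single' l n univ, if_pos (mem_univ l), prod_eq_single l] at h
  · rw [Pi.single_eq_same] at h
    exact Nat.eq_of_mul_eq_mul_left (Nat.factorial_pos n) (by rw [h, mul_one])
  · intro b _ hb
    simp [hb]
  · simp

/-! ### Marginals, closed form of the divergence, and maximum likelihood estimates -/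

section Box

variable {d k : ℕ} {a : Fin k → ℕ}

theorem BoxState.sum_eq (x : BoxState d a) (i : Fin k) : ∑ l, (x i).1 l = a i :=
  (mem_piAntidiag.1 (x i).2).1

theorem BoxState.exists_ne_zero (x : BoxState d a) {i : Fin k} (hi : 1 ≤ a i) :
    ∃ l, (x i).1 l ≠ 0 := by
  by_contra! h
  have := x.sum_eq i
  simp [h] at this
  omega

/-- The number of ordered configurations with the occupation numbers of a state. -/
def boxWeight (x : BoxState d a) : ℕ := ∏ i, Nat.multinomial univ (x i).1

theorem boxWeight_pos (x : BoxState d a) : 0 < boxWeight x :=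
  prod_pos fun _ _ => Nat.multinomial_pos _ _

theorem multinomial_le_boxWeight (x : BoxState d a) (i : Fin k) :
    Nat.multinomial univ (x i).1 ≤ boxWeight x :=
  Nat.le_of_dvd (boxWeight_pos x) (dvd_prod_of_mem _ (mem_univ i))

theorem le_boxWeight_mul (x : BoxState d a) {i : Fin k} {l : Fin (d + 1)} (h : (x i).1 l ≠ 0) :
    a i ≤ boxWeight x * (x i).1 l :=
  (le_multinomial_mul (x.sum_eq i) h).trans
    (Nat.mul_le_mul_right _ (multinomial_le_boxWeight x i))

/-- The average distribution of the variables of group `i` under `p`. -/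
noncomputable def boxMarginal (p : BoxState d a → ℝ) (i : Fin k) (l : Fin (d + 1)) : ℝ :=
  (boxMatrix d a).mulVec p (i, l) / a i

theorem mulVec_boxMatrix (p : BoxState d a → ℝ) (i : Fin k) (l : Fin (d + 1)) :
    (boxMatrix d a).mulVec p (i, l) = ∑ x, p x * ((x i).1 l : ℝ) := by
  simp [Matrix.mulVec, dotProduct, boxMatrix, mul_comm]

theorem mul_boxMarginal (ha : ∀ i, 1 ≤ a i) (p : BoxState d a → ℝ) (i : Fin k)
    (l : Fin (d + 1)) : (a i : ℝ) * boxMarginal p i l = ∑ x, p x * ((x i).1 l : ℝ) := by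
  have : (a i : ℝ) ≠ 0 := by have := ha i; positivity
  rw [boxMarginal, mulVec_boxMatrix]
  field_simp

theorem boxMarginal_mem (ha : ∀ i, 1 ≤ a i) {p : BoxState d a → ℝ}
    (hp : p ∈ stdSimplex ℝ (BoxState d a)) (i : Fin k) :
    boxMarginal p i ∈ stdSimplex ℝ (Fin (d + 1)) := by
  have h0 : (a i : ℝ) ≠ 0 := by have := ha i; positivity
  refine ⟨fun l => ?_, ?_⟩
  · rw [boxMarginal, mulVec_boxMatrix]
    exact div_nonneg (sum_nonneg fun x _ => mul_nonneg (hp.1 x) (Nat.cast_nonneg _))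
      (Nat.cast_nonneg _)
  · apply mul_left_cancel₀ h0
    rw [mul_sum]
    simp only [mul_boxMarginal ha]
    rw [sum_comm]
    simp only [← mul_sum, ← Nat.cast_sum, BoxState.sum_eq, ← sum_mul, hp.2, one_mul, mul_one]

theorem boxParam_ne_zero_iff (s : Fin k → Fin (d + 1) → ℝ) (x : BoxState d a) :
    boxParam d a s x ≠ 0 ↔ ∀ i l, (x i).1 l ≠ 0 → s i l ≠ 0 := by
  have : ∀ i, ((Nat.multinomial univ (x i).1 : ℕ) : ℝ) ≠ 0 := fun i =>
    Nat.cast_ne_zero.2 (Nat.multinomial_pos _ _).ne'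
  simp only [boxParam, prod_ne_zero_iff, mem_univ, true_imp_iff, mul_ne_zero_iff, pow_eq_zero_iff',
    ne_eq, not_and, not_not]
  exact ⟨fun h i l hx hs => hx ((h i).2 l hs),
    fun h i => ⟨this i, fun l hs => by_contra fun hx => h i l hx hs⟩⟩

theorem log_boxParam (s : Fin k → Fin (d + 1) → ℝ) (x : BoxState d a)
    (h : boxParam d a s x ≠ 0) :
    Real.log (boxParam d a s x) =
      Real.log (boxWeight x) + ∑ i, ∑ l, ((x i).1 l : ℝ) * Real.log (s i l) := by
  have hs := (boxParam_ne_zero_iff s x).1 h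
  have h1 : boxParam d a s x = (boxWeight x : ℝ) * ∏ i, ∏ l, s i l ^ (x i).1 l := by
    simp [boxParam, boxWeight, prod_mul_distrib]
  have hpow : ∀ i l, s i l ^ (x i).1 l ≠ 0 := fun i l h0 => by
    rw [pow_eq_zero_iff'] at h0
    exact hs i l h0.2 h0.1
  rw [h1, Real.log_mul (Nat.cast_ne_zero.2 (boxWeight_pos x).ne')
    (prod_ne_zero_iff.2 fun i _ => prod_ne_zero_iff.2 fun l _ => hpow i l),
    Real.log_prod fun i _ => prod_ne_zero_iff.2 fun l _ => hpow i l]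
  congr 1
  refine sum_congr rfl fun i _ => ?_
  rw [Real.log_prod fun l _ => hpow i l]
  simp only [Real.log_pow]

theorem support_subset_boxParam_iff (ha : ∀ i, 1 ≤ a i) {p : BoxState d a → ℝ}
    (hp : p ∈ stdSimplex ℝ (BoxState d a)) (s : Fin k → Fin (d + 1) → ℝ) :
    Function.support p ⊆ Function.support (boxParam d a s) ↔
      ∀ i l, boxMarginal p i l ≠ 0 → s i l ≠ 0 := by
  have h0 : ∀ i, (a i : ℝ) ≠ 0 := fun i => by have := ha i; positivity
  have key : ∀ i l, boxMarginal p i l ≠ 0 ↔ ∃ x, p x ≠ 0 ∧ (x i).1 l ≠ 0 := by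
    intro i l
    rw [← not_iff_not, not_not, ← mul_right_inj' (h0 i), mul_boxMarginal ha, mul_zero,
      sum_eq_zero_iff_of_nonneg fun x _ => mul_nonneg (hp.1 x) (Nat.cast_nonneg _)]
    simp [or_iff_not_imp_left]
  simp only [key, Set.subset_def, Function.mem_support, boxParam_ne_zero_iff]
  exact ⟨fun h i l ⟨x, hx, hl⟩ => h x hx i l hl, fun h x hx i l hl => h i l ⟨x, hx, hl⟩⟩

/-- The divergence from `p` to the box model in closed form. -/
noncomputable def boxDiv (p : BoxState d a → ℝ) : ℝ :=
  ∑ x, p x * Real.log (p x / boxWeight x) -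
    ∑ i, (a i : ℝ) * ∑ l, boxMarginal p i l * Real.log (boxMarginal p i l)

/-- The parameter enters `log (boxParam d a s x)` linearly in the counts of `x`, so after averaging
over `p` only the marginals of `p` meet `log s`. -/
theorem infoDiv_boxParam (ha : ∀ i, 1 ≤ a i) {p : BoxState d a → ℝ}
    (hp : p ∈ stdSimplex ℝ (BoxState d a)) {s : Fin k → Fin (d + 1) → ℝ}
    (h : ∀ i l, boxMarginal p i l ≠ 0 → s i l ≠ 0) :
    infoDiv p (boxParam d a s) = ((boxDiv p + ∑ i, (a i : ℝ) * ∑ l, boxMarginal p i l *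
      (Real.log (boxMarginal p i l) - Real.log (s i l)) : ℝ) : EReal) := by
  have hsupp := (support_subset_boxParam_iff ha hp s).2 h
  rw [infoDiv, if_pos hsupp, EReal.coe_eq_coe_iff]
  have h1 : ∀ x, p x * Real.log (p x / boxParam d a s x) =
      p x * Real.log (p x / boxWeight x) -
        ∑ i, ∑ l, (p x * ((x i).1 l : ℝ)) * Real.log (s i l) := by
    intro x
    by_cases hx : p x = 0
    · simp [hx]
    · have hq : boxParam d a s x ≠ 0 := hsupp hx
      rw [Real.log_div hx hq, log_boxParam s x hq,
        Real.log_div hx (Nat.cast_ne_zero.2 (boxWeight_pos x).ne')]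
      simp only [mul_assoc, ← mul_sum]
      ring
  have h2 : ∑ x, ∑ i, ∑ l, (p x * ((x i).1 l : ℝ)) * Real.log (s i l) =
      ∑ i, (a i : ℝ) * ∑ l, boxMarginal p i l * Real.log (s i l) := by
    rw [sum_comm]
    refine sum_congr rfl fun i _ => ?_
    rw [sum_comm, mul_sum]
    refine sum_congr rfl fun l _ => ?_
    rw [← sum_mul, ← mul_boxMarginal ha, mul_assoc]
  simp only [h1]
  rw [sum_sub_distrib, h2, boxDiv]
  simp only [mul_sub, sum_sub_distrib]
  ring

theorem infoDiv_boxParam_boxMarginal (ha : ∀ i, 1 ≤ a i) {p : BoxState d a → ℝ}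
    (hp : p ∈ stdSimplex ℝ (BoxState d a)) :
    infoDiv p (boxParam d a (boxMarginal p)) = (boxDiv p : EReal) := by
  rw [infoDiv_boxParam ha hp fun _ _ h => h]
  simp

theorem boxDiv_le_infoDiv (ha : ∀ i, 1 ≤ a i) {p : BoxState d a → ℝ}
    (hp : p ∈ stdSimplex ℝ (BoxState d a)) {s : Fin k → Fin (d + 1) → ℝ}
    (hs : ∀ i, s i ∈ stdSimplex ℝ (Fin (d + 1))) :
    (boxDiv p : EReal) ≤ infoDiv p (boxParam d a s) := by
  by_cases h : ∀ i l, boxMarginal p i l ≠ 0 → s i l ≠ 0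
  · rw [infoDiv_boxParam ha hp h, EReal.coe_le_coe_iff]
    exact le_add_of_nonneg_right (sum_nonneg fun i _ => mul_nonneg (Nat.cast_nonneg _)
      (klSum_nonneg (boxMarginal_mem ha hp i) (hs i) (h i)))
  · rw [infoDiv, if_neg (mt (support_subset_boxParam_iff ha hp s).1 h)]
    exact le_top

theorem eq_boxMarginal_of_infoDiv_eq (ha : ∀ i, 1 ≤ a i) {p : BoxState d a → ℝ}
    (hp : p ∈ stdSimplex ℝ (BoxState d a)) {s : Fin k → Fin (d + 1) → ℝ}
    (hs : ∀ i, s i ∈ stdSimplex ℝ (Fin (d + 1)))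
    (heq : infoDiv p (boxParam d a s) = boxDiv p) : s = boxMarginal p := by
  by_cases h : ∀ i l, boxMarginal p i l ≠ 0 → s i l ≠ 0
  · rw [infoDiv_boxParam ha hp h, EReal.coe_eq_coe_iff, add_eq_left,
      sum_eq_zero_iff_of_nonneg fun i _ => mul_nonneg (Nat.cast_nonneg _)
      (klSum_nonneg (boxMarginal_mem ha hp i) (hs i) (h i))] at heq
    funext i
    have h0 : (a i : ℝ) ≠ 0 := by have := ha i; positivity
    exact (eq_of_klSum_eq_zero (boxMarginal_mem ha hp i) (hs i) (h i)
      ((mul_eq_zero.1 (heq i (mem_univ i))).resolve_left h0)).symm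
  · rw [infoDiv, if_neg (mt (support_subset_boxParam_iff ha hp s).1 h)] at heq
    exact absurd heq.symm (EReal.coe_ne_top _)

theorem isLeast_boxDiv (ha : ∀ i, 1 ≤ a i) {p : BoxState d a → ℝ}
    (hp : p ∈ stdSimplex ℝ (BoxState d a)) :
    IsLeast (infoDiv p '' boxModel d a) (boxDiv p) := by
  refine ⟨⟨_, ⟨boxMarginal p, boxMarginal_mem ha hp, rfl⟩, infoDiv_boxParam_boxMarginal ha hp⟩, ?_⟩
  rintro _ ⟨_, ⟨s, hs, rfl⟩, rfl⟩
  exact boxDiv_le_infoDiv ha hp hs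

theorem divergenceTo_boxModel (ha : ∀ i, 1 ≤ a i) {p : BoxState d a → ℝ}
    (hp : p ∈ stdSimplex ℝ (BoxState d a)) : divergenceTo (boxModel d a) p = boxDiv p :=
  (isLeast_boxDiv ha hp).csInf_eq

theorem mem_logVoronoiCell_boxParam_iff (ha : ∀ i, 1 ≤ a i) {s : Fin k → Fin (d + 1) → ℝ}
    (hs : ∀ i, s i ∈ stdSimplex ℝ (Fin (d + 1))) {p : BoxState d a → ℝ} :
    p ∈ logVoronoiCell (boxModel d a) (boxParam d a s) ↔
      p ∈ stdSimplex ℝ (BoxState d a) ∧ boxMarginal p = s := by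
  constructor
  · rintro ⟨hp, -, h⟩
    rw [divergenceTo_boxModel ha hp] at h
    exact ⟨hp, (eq_boxMarginal_of_infoDiv_eq ha hp hs h).symm⟩
  · rintro ⟨hp, rfl⟩
    exact ⟨hp, ⟨_, hs, rfl⟩, by
      rw [divergenceTo_boxModel ha hp, infoDiv_boxParam_boxMarginal ha hp]⟩

theorem boxParam_mem_stdSimplex {s : Fin k → Fin (d + 1) → ℝ}
    (hs : ∀ i, s i ∈ stdSimplex ℝ (Fin (d + 1))) :
    boxParam d a s ∈ stdSimplex ℝ (BoxState d a) := by
  refine ⟨fun x => prod_nonneg fun i _ => mul_nonneg (Nat.cast_nonneg _)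
    (prod_nonneg fun l _ => pow_nonneg ((hs i).1 l) _), ?_⟩
  have h : ∀ i, ∑ j : {j : Fin (d + 1) → ℕ // j ∈ piAntidiag univ (a i)},
      ((Nat.multinomial univ j.1 : ℕ) : ℝ) * ∏ l, s i l ^ j.1 l = 1 := by
    intro i
    rw [Finset.sum_coe_sort (piAntidiag univ (a i))
      (fun j => ((Nat.multinomial univ j : ℕ) : ℝ) * ∏ l, s i l ^ j l),
      ← sum_pow_eq_sum_piAntidiag, (hs i).2, one_pow]
  simp only [boxParam]
  rw [← Fintype.prod_sum (fun i (j : {j : Fin (d + 1) → ℕ // j ∈ piAntidiag univ (a i)}) =>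
    ((Nat.multinomial univ j.1 : ℕ) : ℝ) * ∏ l, s i l ^ j.1 l)]
  exact prod_eq_one fun i _ => h i

/-- No moments are computed: `boxParam d a s` has divergence zero to itself, while its `boxDiv` is a
divergence between two distributions and so nonnegative. Hence `s` is an optimal parameter, and
uniqueness identifies it with the marginal. -/
theorem boxMarginal_boxParam (ha : ∀ i, 1 ≤ a i) {s : Fin k → Fin (d + 1) → ℝ}
    (hs : ∀ i, s i ∈ stdSimplex ℝ (Fin (d + 1))) : boxMarginal (boxParam d a s) = s := by
  have hq := boxParam_mem_stdSimplex (a := a) hs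
  have hq' := boxParam_mem_stdSimplex (a := a) (boxMarginal_mem ha hq)
  have h0 : infoDiv (boxParam d a s) (boxParam d a s) = 0 := by
    rw [infoDiv, if_pos subset_rfl, EReal.coe_eq_zero]
    refine sum_eq_zero fun x _ => ?_
    by_cases hx : boxParam d a s x = 0
    · simp [hx]
    · simp [div_self hx]
  have h1 : 0 ≤ infoDiv (boxParam d a s) (boxParam d a (boxMarginal (boxParam d a s))) := by
    have hsupp := (support_subset_boxParam_iff ha hq (boxMarginal (boxParam d a s))).2
      fun _ _ h => h
    rw [infoDiv, if_pos hsupp, EReal.coe_nonneg]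
    refine (klSum_nonneg hq hq' hsupp).trans_eq (sum_congr rfl fun x _ => ?_)
    by_cases hx : boxParam d a s x = 0
    · simp [hx]
    · rw [Real.log_div hx (hsupp hx)]
  rw [infoDiv_boxParam_boxMarginal ha hq] at h1
  refine (eq_boxMarginal_of_infoDiv_eq ha hq hs (le_antisymm ?_ ?_)).symm
  · rwa [h0]
  · exact boxDiv_le_infoDiv ha hq hs

end Box

/-! ### The upper bound -/

section Box

variable {d k : ℕ} {a : Fin k → ℕ}

theorem weight_div_le_boxMarginal (ha : ∀ i, 1 ≤ a i) {p : BoxState d a → ℝ}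
    (hp : p ∈ stdSimplex ℝ (BoxState d a)) (x : BoxState d a) (i : Fin k) {l : Fin (d + 1)}
    (hl : (x i).1 l ≠ 0) : p x / boxWeight x ≤ boxMarginal p i l := by
  have h0 : (0 : ℝ) < a i := by have := ha i; positivity
  have hw : (0 : ℝ) < boxWeight x := Nat.cast_pos.2 (boxWeight_pos x)
  have h1 : p x * ((x i).1 l : ℝ) ≤ a i * boxMarginal p i l := by
    rw [mul_boxMarginal ha]
    exact single_le_sum (f := fun x : BoxState d a => p x * ((x i).1 l : ℝ))
      (fun y _ => mul_nonneg (hp.1 y) (Nat.cast_nonneg _)) (mem_univ x)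
  have h2 : (a i : ℝ) ≤ boxWeight x * ((x i).1 l : ℝ) := by exact_mod_cast le_boxWeight_mul x hl
  rw [div_le_iff₀ hw]
  refine le_of_mul_le_mul_left ?_ h0
  calc (a i : ℝ) * p x ≤ boxWeight x * ((x i).1 l : ℝ) * p x :=
        mul_le_mul_of_nonneg_right h2 (hp.1 x)
    _ = (p x * ((x i).1 l : ℝ)) * boxWeight x := by ring
    _ ≤ (a i * boxMarginal p i l) * boxWeight x := mul_le_mul_of_nonneg_right h1 hw.le
    _ = _ := by ring

/-- After multiplication by `a i`, which is the sum of the counts in group `i` of each state, both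
sides become sums over pairs `(x, l)` with weight `p x` times the count of `l`; the logarithms
compare termwise. -/
theorem sum_mul_log_weight_le (ha : ∀ i, 1 ≤ a i) {p : BoxState d a → ℝ}
    (hp : p ∈ stdSimplex ℝ (BoxState d a)) (i : Fin k) :
    ∑ x, p x * Real.log (p x / boxWeight x) ≤
      ∑ l, boxMarginal p i l * Real.log (boxMarginal p i l) := by
  have h0 : (0 : ℝ) < a i := by have := ha i; positivity
  refine le_of_mul_le_mul_left ?_ h0
  rw [mul_sum, mul_sum]
  simp only [← mul_assoc, mul_boxMarginal ha]
  simp only [sum_mul]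
  rw [sum_comm]
  refine sum_le_sum fun x _ => ?_
  have hx : (a i : ℝ) = ∑ l, ((x i).1 l : ℝ) := by exact_mod_cast (x.sum_eq i).symm
  rw [hx, sum_mul, sum_mul]
  refine sum_le_sum fun l _ => ?_
  rcases (hp.1 x).eq_or_lt with h | h
  · simp [← h]
  by_cases hl : (x i).1 l = 0
  · simp [hl]
  rw [mul_comm (p x)]
  refine mul_le_mul_of_nonneg_left ?_ (by positivity)
  exact Real.log_le_log (div_pos h (Nat.cast_pos.2 (boxWeight_pos x)))
    (weight_div_le_boxMarginal ha hp x i hl)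

/-- Group `i` absorbs the first sum of `boxDiv`. The entropy deficit of a second group `j` is kept
on the left, so that equality in the bound makes it vanish. -/
theorem boxDiv_add_le (ha : ∀ i, 1 ≤ a i) {p : BoxState d a → ℝ}
    (hp : p ∈ stdSimplex ℝ (BoxState d a)) (i j : Fin k) (hij : i ≠ j) :
    boxDiv p + (∑ l, boxMarginal p j l * Real.log (boxMarginal p j l) + Real.log ((d : ℝ) + 1)) ≤
      ((∑ i, (a i : ℝ)) - 1) * Real.log ((d : ℝ) + 1) := by
  have h1 := sum_mul_log_weight_le ha hp i
  set e : Fin k → ℝ := fun i =>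
    ∑ l, boxMarginal p i l * Real.log (boxMarginal p i l) + Real.log ((d : ℝ) + 1) with he
  have hnn : ∀ i, 0 ≤ e i := fun i => by
    have := neg_log_le_sum_mul_log d (boxMarginal_mem ha hp i)
    simp only [he]
    linarith
  have hle : ∀ i, e i ≤ a i * e i := fun i =>
    le_mul_of_one_le_left (hnn i) (by exact_mod_cast ha i)
  have h2 : e i + e j ≤ ∑ i, (a i : ℝ) * e i := by
    rw [← sum_pair hij]
    exact (sum_le_sum fun i _ => hle i).trans
      (sum_le_univ_sum_of_nonneg fun i => (hnn i).trans (hle i))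
  have h3 : ∑ i, (a i : ℝ) * e i =
      ∑ i, (a i : ℝ) * ∑ l, boxMarginal p i l * Real.log (boxMarginal p i l) +
        (∑ i, (a i : ℝ)) * Real.log ((d : ℝ) + 1) := by
    simp only [he, mul_add, sum_add_distrib, ← sum_mul]
  rw [h3] at h2
  simp only [he] at h2
  rw [boxDiv]
  linarith

theorem boxDiv_le (hk : 2 ≤ k) (ha : ∀ i, 1 ≤ a i) {p : BoxState d a → ℝ}
    (hp : p ∈ stdSimplex ℝ (BoxState d a)) :
    boxDiv p ≤ ((∑ i, (a i : ℝ)) - 1) * Real.log ((d : ℝ) + 1) := by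
  have h := boxDiv_add_le ha hp ⟨0, by omega⟩ ⟨1, by omega⟩ (by simp)
  have := neg_log_le_sum_mul_log d (boxMarginal_mem ha hp ⟨1, by omega⟩)
  linarith

/-! ### The equality case and the permutation points -/

theorem boxMarginal_eq_const_of_boxDiv_eq (hk : 2 ≤ k) (ha : ∀ i, 1 ≤ a i)
    {p : BoxState d a → ℝ} (hp : p ∈ stdSimplex ℝ (BoxState d a))
    (h : boxDiv p = ((∑ i, (a i : ℝ)) - 1) * Real.log ((d : ℝ) + 1)) :
    boxMarginal p = fun _ _ => 1 / ((d : ℝ) + 1) := by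
  funext j
  have : Nontrivial (Fin k) := Fin.nontrivial_iff_two_le.2 hk
  obtain ⟨i, hij⟩ := exists_ne j
  have h1 := boxDiv_add_le ha hp i j hij
  have h2 := neg_log_le_sum_mul_log d (boxMarginal_mem ha hp j)
  exact eq_const_of_sum_mul_log_eq d (boxMarginal_mem ha hp j) (by linarith)

/-- Uniform marginals give `p x / w x ≤ 1 / (d + 1)` on the support, while maximality says that the
`p`-average of `log (p / w)` equals `log (1 / (d + 1))`; no term can be strict. -/
theorem eq_weight_div_of_boxDiv_eq (hk : 2 ≤ k) (ha : ∀ i, 1 ≤ a i)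
    {p : BoxState d a → ℝ} (hp : p ∈ stdSimplex ℝ (BoxState d a))
    (h : boxDiv p = ((∑ i, (a i : ℝ)) - 1) * Real.log ((d : ℝ) + 1)) {x : BoxState d a}
    (hx : p x ≠ 0) : p x = boxWeight x / ((d : ℝ) + 1) := by
  have hm := boxMarginal_eq_const_of_boxDiv_eq hk ha hp h
  have hd : (0 : ℝ) < 1 / ((d : ℝ) + 1) := by positivity
  have hw : ∀ x : BoxState d a, (0 : ℝ) < boxWeight x := fun x =>
    Nat.cast_pos.2 (boxWeight_pos x)
  have hsum : ∑ x, p x * Real.log (p x / boxWeight x) =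
      ∑ x, p x * Real.log (1 / ((d : ℝ) + 1)) := by
    rw [← sum_mul, hp.2]
    rw [boxDiv, hm] at h
    simp only [one_div, Real.log_inv, ← mul_sum, sum_const, card_univ, Fintype.card_fin,
      nsmul_eq_mul, ← sum_mul] at h ⊢
    have h3 : ((d : ℝ) + 1)⁻¹ * (((d + 1 : ℕ) : ℝ) * -Real.log ((d : ℝ) + 1)) =
        -Real.log ((d : ℝ) + 1) := by
      push_cast
      field_simp
    rw [h3] at h
    linarith
  have hpos : ∀ x, p x ≠ 0 → 0 < p x := fun x hx => lt_of_le_of_ne (hp.1 x) (Ne.symm hx)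
  have hle : ∀ x, p x ≠ 0 → p x / boxWeight x ≤ 1 / ((d : ℝ) + 1) := by
    intro x hx
    obtain ⟨l, hl⟩ := x.exists_ne_zero (ha ⟨0, by omega⟩)
    exact (weight_div_le_boxMarginal ha hp x _ hl).trans_eq (by rw [hm])
  have hterm := (sum_eq_sum_iff_of_le fun x _ => ?_).1 hsum x (mem_univ x)
  · have h1 := Real.log_injOn_pos (div_pos (hpos x hx) (hw x)) hd (mul_left_cancel₀ hx hterm)
    rw [div_eq_iff (hw x).ne'] at h1
    rw [h1]
    ring
  · by_cases hx : p x = 0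
    · simp [hx]
    · exact mul_le_mul_of_nonneg_left
        (Real.log_le_log (div_pos (hpos x hx) (hw x)) (hle x hx)) (hp.1 x)

theorem mul_apply_le_of_boxMarginal_eq (ha : ∀ i, 1 ≤ a i) {p : BoxState d a → ℝ}
    (hp : p ∈ stdSimplex ℝ (BoxState d a)) (hm : boxMarginal p = fun _ _ => 1 / ((d : ℝ) + 1))
    (S : Finset (BoxState d a)) (i : Fin k) (l : Fin (d + 1)) :
    ∑ x ∈ S, p x * ((x i).1 l : ℝ) ≤ a i / ((d : ℝ) + 1) := by
  have h := mul_boxMarginal ha p i l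
  rw [hm] at h
  calc _ ≤ ∑ x, p x * ((x i).1 l : ℝ) := sum_le_univ_sum_of_nonneg fun y =>
        mul_nonneg (hp.1 y) (Nat.cast_nonneg _)
    _ = _ := by rw [← h]; ring

theorem boxWeight_eq_one_of_boxDiv_eq (hk : 2 ≤ k) (ha : ∀ i, 1 ≤ a i)
    {p : BoxState d a → ℝ} (hp : p ∈ stdSimplex ℝ (BoxState d a))
    (h : boxDiv p = ((∑ i, (a i : ℝ)) - 1) * Real.log ((d : ℝ) + 1)) {x : BoxState d a}
    (hx : p x ≠ 0) : boxWeight x = 1 := by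
  have hm := boxMarginal_eq_const_of_boxDiv_eq hk ha hp h
  have hle : ∀ i, boxWeight x ≤ Nat.multinomial univ (x i).1 := by
    intro i
    obtain ⟨l, hl⟩ := x.exists_ne_zero (ha i)
    have h1 := mul_apply_le_of_boxMarginal_eq ha hp hm {x} i l
    rw [sum_singleton, eq_weight_div_of_boxDiv_eq hk ha hp h hx, div_mul_eq_mul_div,
      div_le_div_iff_of_pos_right (by positivity)] at h1
    have h2 : boxWeight x * (x i).1 l ≤ a i := by exact_mod_cast h1
    exact Nat.le_of_mul_le_mul_right (h2.trans (le_multinomial_mul (x.sum_eq i) hl))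
      (Nat.pos_of_ne_zero hl)
  have hij : (⟨0, by omega⟩ : Fin k) ≠ ⟨1, by omega⟩ := by simp
  have hprod : Nat.multinomial univ (x ⟨0, by omega⟩).1 * Nat.multinomial univ (x ⟨1, by omega⟩).1
      ≤ boxWeight x := by
    rw [← prod_pair (f := fun i => Nat.multinomial univ (x i).1) hij]
    exact Nat.le_of_dvd (boxWeight_pos x) (prod_dvd_prod_of_subset _ _ _ (subset_univ _))
  -- The weight is at most each of two distinct factors of itself, so its square is at most itself.
  have h2 := (Nat.mul_le_mul (hle _) (hle _)).trans hprod
  have h3 := boxWeight_pos x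
  nlinarith

/-- The state in which all variables of group `i` are in state `f i`. -/
def boxVertex (a : Fin k → ℕ) (f : Fin k → Fin (d + 1)) : BoxState d a := fun i =>
  ⟨Pi.single (f i) (a i), by simp [mem_piAntidiag]⟩

theorem boxVertex_apply (f : Fin k → Fin (d + 1)) (i : Fin k) (l : Fin (d + 1)) :
    (boxVertex a f i).1 l = if l = f i then a i else 0 := by
  simp [boxVertex, Pi.single_apply]

theorem boxVertex_injective (ha : ∀ i, 1 ≤ a i) :
    Function.Injective (boxVertex a : (Fin k → Fin (d + 1)) → BoxState d a) := by
  intro f g hfg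
  funext i
  by_contra hne
  have h := boxVertex_apply (a := a) g i (f i)
  rw [← hfg, boxVertex_apply, if_pos rfl, if_neg hne] at h
  have := ha i
  omega

theorem boxWeight_boxVertex (f : Fin k → Fin (d + 1)) : boxWeight (boxVertex a f) = 1 :=
  prod_eq_one fun i _ => multinomial_single (f i) (a i)

theorem exists_eq_boxVertex (ha : ∀ i, 1 ≤ a i) {x : BoxState d a} (hx : boxWeight x = 1) :
    ∃ f, x = boxVertex a f := by
  choose f hf using fun i => x.exists_ne_zero (ha i)
  refine ⟨f, ?_⟩
  funext i
  apply Subtype.ext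
  have h1 := le_boxWeight_mul x (hf i)
  have h3 := x.sum_eq i
  rw [hx, one_mul] at h1
  have h2 : ∑ l ∈ univ.erase (f i), (x i).1 l = 0 := by
    have h4 := add_sum_erase univ (x i).1 (mem_univ (f i))
    omega
  rw [sum_eq_zero_iff] at h2
  rw [sum_eq_single (f i) (fun l _ hl => h2 l (mem_erase.2 ⟨hl, mem_univ l⟩)) (by simp)] at h3
  funext l
  rw [boxVertex_apply]
  split_ifs with h
  · rw [h, h3]
  · exact h2 l (mem_erase.2 ⟨h, mem_univ l⟩)

/-- The uniform distribution on the states `(σ₁ l, …, σₖ l)`. -/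
noncomputable def permPoint (a : Fin k → ℕ) (σ : Fin k → Equiv.Perm (Fin (d + 1))) :
    BoxState d a → ℝ := fun x =>
  ∑ l, if x = boxVertex a (fun i => σ i l) then 1 / ((d : ℝ) + 1) else 0

theorem sum_permPoint_mul (σ : Fin k → Equiv.Perm (Fin (d + 1))) (g : BoxState d a → ℝ) :
    ∑ x, permPoint a σ x * g x = ∑ l, 1 / ((d : ℝ) + 1) * g (boxVertex a fun i => σ i l) := by
  simp only [permPoint, sum_mul]
  rw [sum_comm]
  simp

theorem permPoint_mem (σ : Fin k → Equiv.Perm (Fin (d + 1))) :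
    permPoint a σ ∈ stdSimplex ℝ (BoxState d a) := by
  refine ⟨fun x => sum_nonneg fun l _ => by split_ifs <;> positivity, ?_⟩
  have h := sum_permPoint_mul (a := a) σ fun _ => 1
  simp only [mul_one] at h
  rw [h]
  exact (const_mem_stdSimplex d).2

theorem permPoint_boxVertex (hk : 0 < k) (ha : ∀ i, 1 ≤ a i)
    (σ : Fin k → Equiv.Perm (Fin (d + 1))) (l : Fin (d + 1)) :
    permPoint a σ (boxVertex a fun i => σ i l) = 1 / ((d : ℝ) + 1) := by
  rw [permPoint, sum_eq_single l]
  · simp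
  · intro m _ hm
    rw [if_neg]
    intro h
    exact hm ((σ ⟨0, hk⟩).injective (congrFun (boxVertex_injective ha h) ⟨0, hk⟩)).symm
  · simp

theorem exists_of_permPoint_ne_zero {σ : Fin k → Equiv.Perm (Fin (d + 1))} {x : BoxState d a}
    (hx : permPoint a σ x ≠ 0) : ∃ l, x = boxVertex a fun i => σ i l := by
  obtain ⟨l, -, hl⟩ := exists_ne_zero_of_sum_ne_zero hx
  exact ⟨l, by by_contra h; simp [h] at hl⟩

theorem boxMarginal_permPoint (ha : ∀ i, 1 ≤ a i) (σ : Fin k → Equiv.Perm (Fin (d + 1))) :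
    boxMarginal (permPoint a σ) = fun _ _ => 1 / ((d : ℝ) + 1) := by
  funext i l
  have h0 : (a i : ℝ) ≠ 0 := by have := ha i; positivity
  apply mul_left_cancel₀ h0
  rw [mul_boxMarginal ha, sum_permPoint_mul σ fun x => ((x i).1 l : ℝ)]
  simp only [boxVertex_apply]
  rw [sum_eq_single ((σ i).symm l)]
  · simp [mul_comm]
  · intro m _ hm
    rw [if_neg]
    · simp
    · rintro rfl
      simp at hm
  · simp

theorem boxDiv_permPoint (hk : 0 < k) (ha : ∀ i, 1 ≤ a i)
    (σ : Fin k → Equiv.Perm (Fin (d + 1))) :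
    boxDiv (permPoint a σ) = ((∑ i, (a i : ℝ)) - 1) * Real.log ((d : ℝ) + 1) := by
  rw [boxDiv, boxMarginal_permPoint ha, sum_permPoint_mul σ
    fun x => Real.log (permPoint a σ x / boxWeight x)]
  simp only [permPoint_boxVertex hk ha, boxWeight_boxVertex, Nat.cast_one, div_one]
  have : ∑ _l : Fin (d + 1), 1 / ((d : ℝ) + 1) * Real.log (1 / ((d : ℝ) + 1)) =
      -Real.log ((d : ℝ) + 1) := by
    rw [← sum_mul, (const_mem_stdSimplex d).2, one_mul, one_div, Real.log_inv]
  rw [this, ← sum_mul]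
  ring

/-- Each vertex state in the support has mass `1 / (d + 1)` and so already exhausts the uniform
marginal at its label in group `i`; a second one would exceed it. -/
theorem eq_of_common_coordinate (hk : 2 ≤ k) (ha : ∀ i, 1 ≤ a i)
    {p : BoxState d a → ℝ} (hp : p ∈ stdSimplex ℝ (BoxState d a))
    (h : boxDiv p = ((∑ i, (a i : ℝ)) - 1) * Real.log ((d : ℝ) + 1))
    {f g : Fin k → Fin (d + 1)} (hf : p (boxVertex a f) ≠ 0) (hg : p (boxVertex a g) ≠ 0)
    {i : Fin k} (hi : f i = g i) : f = g := by
  by_contra hne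
  have hm := boxMarginal_eq_const_of_boxDiv_eq hk ha hp h
  have h0 : (0 : ℝ) < a i := by have := ha i; positivity
  have h1 := mul_apply_le_of_boxMarginal_eq ha hp hm {boxVertex a f, boxVertex a g} i (f i)
  rw [sum_pair ((boxVertex_injective ha).ne hne), eq_weight_div_of_boxDiv_eq hk ha hp h hf,
    eq_weight_div_of_boxDiv_eq hk ha hp h hg, boxWeight_boxVertex, boxWeight_boxVertex,
    boxVertex_apply, boxVertex_apply, if_pos rfl, if_pos hi, Nat.cast_one, one_div_mul_eq_div] at h1
  have : 0 < (a i : ℝ) / ((d : ℝ) + 1) := by positivity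
  linarith

theorem exists_eq_permPoint (hk : 2 ≤ k) (ha : ∀ i, 1 ≤ a i)
    {p : BoxState d a → ℝ} (hp : p ∈ stdSimplex ℝ (BoxState d a))
    (h : boxDiv p = ((∑ i, (a i : ℝ)) - 1) * Real.log ((d : ℝ) + 1)) (i₀ : Fin k) :
    ∃ σ : Fin k → Equiv.Perm (Fin (d + 1)), σ i₀ = 1 ∧ permPoint a σ = p := by
  have hm := boxMarginal_eq_const_of_boxDiv_eq hk ha hp h
  have hex : ∀ l, ∃ f : Fin k → Fin (d + 1), p (boxVertex a f) ≠ 0 ∧ f i₀ = l := by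
    intro l
    have h1 := mul_boxMarginal ha p i₀ l
    rw [hm] at h1
    have h0 : (a i₀ : ℝ) * (1 / ((d : ℝ) + 1)) ≠ 0 := by
      have := ha i₀
      positivity
    rw [h1] at h0
    obtain ⟨x, -, hx⟩ := exists_ne_zero_of_sum_ne_zero h0
    rw [mul_ne_zero_iff, Nat.cast_ne_zero] at hx
    obtain ⟨f, rfl⟩ := exists_eq_boxVertex ha (boxWeight_eq_one_of_boxDiv_eq hk ha hp h hx.1)
    refine ⟨f, hx.1, ?_⟩
    by_contra hne
    exact hx.2 (by rw [boxVertex_apply, if_neg (Ne.symm hne)])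
  choose F hF hF0 using hex
  -- Support states sharing a label in group `i` coincide, hence so do their labels in group `i₀`.
  have hinj : ∀ i, Function.Injective fun l => F l i := fun i l m hlm => by
    rw [← hF0 l, ← hF0 m, eq_of_common_coordinate hk ha hp h (hF l) (hF m) hlm]
  let σ : Fin k → Equiv.Perm (Fin (d + 1)) := fun i =>
    Equiv.ofBijective _ (Finite.injective_iff_bijective.1 (hinj i))
  have hσ : ∀ l, (fun i => σ i l) = F l := fun l => rfl
  refine ⟨σ, Equiv.ext fun l => hF0 l, ?_⟩
  funext x
  by_cases hx : p x = 0
  · rw [hx]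
    by_contra hne
    obtain ⟨l, rfl⟩ := exists_of_permPoint_ne_zero hne
    exact hF l hx
  · obtain ⟨f, rfl⟩ := exists_eq_boxVertex ha (boxWeight_eq_one_of_boxDiv_eq hk ha hp h hx)
    have hfF : f = F (f i₀) := eq_of_common_coordinate hk ha hp h hx (hF _) (hF0 (f i₀)).symm
    rw [eq_weight_div_of_boxDiv_eq hk ha hp h hx, boxWeight_boxVertex, Nat.cast_one, hfF, ← hσ,
      permPoint_boxVertex (by omega) ha]

/-- Equal points have equal supports, which fixes the permutations up to a common reparametrization;
agreement at `i₀` makes it trivial. -/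
theorem eq_of_permPoint_eq (ha : ∀ i, 1 ≤ a i) {σ τ : Fin k → Equiv.Perm (Fin (d + 1))}
    {i₀ : Fin k} (h0 : σ i₀ = τ i₀) (h : permPoint a σ = permPoint a τ) : σ = τ := by
  funext i
  ext1 l
  have h1 : permPoint a τ (boxVertex a fun i => σ i l) ≠ 0 := by
    rw [← h, permPoint_boxVertex i₀.pos ha]
    positivity
  obtain ⟨m, hm⟩ := exists_of_permPoint_ne_zero h1
  have hm' := fun i => congrFun (boxVertex_injective ha hm) i
  have hl : l = m := (σ i₀).injective ((hm' i₀).trans (by rw [h0]))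
  rw [hm' i, hl]

/-! ### The polytope of the centroid and its vertices -/

theorem mem_fiberPolytope_boxCentroid_iff (ha : ∀ i, 1 ≤ a i) {p : BoxState d a → ℝ} :
    p ∈ fiberPolytope (boxMatrix d a) (boxCentroid d a) ↔
      p ∈ stdSimplex ℝ (BoxState d a) ∧ boxMarginal p = fun _ _ => 1 / ((d : ℝ) + 1) := by
  have h0 : ∀ i, (a i : ℝ) ≠ 0 := fun i => by have := ha i; positivity
  refine and_congr_right fun _ => ⟨fun h => ?_, fun h => ?_⟩
  · funext i l
    rw [boxMarginal, h, boxCentroid]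
    field_simp [h0 i]
  · funext ⟨i, l⟩
    have h1 := congrFun (congrFun h i) l
    rw [boxMarginal, div_eq_iff (h0 i)] at h1
    rw [h1, boxCentroid]
    ring

/-- Exactly one state of the support carries a given label in group `0`, so the marginal of that
group determines its mass. -/
theorem eq_permPoint_of_support_subset (hk : 0 < k) (ha : ∀ i, 1 ≤ a i)
    {σ : Fin k → Equiv.Perm (Fin (d + 1))} {p : BoxState d a → ℝ}
    (hm : boxMarginal p = fun _ _ => 1 / ((d : ℝ) + 1))
    (hsupp : ∀ x, permPoint a σ x = 0 → p x = 0) : p = permPoint a σ := by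
  funext x
  by_cases hx : permPoint a σ x = 0
  · rw [hx, hsupp x hx]
  obtain ⟨l, rfl⟩ := exists_of_permPoint_ne_zero hx
  have h0 : (a ⟨0, hk⟩ : ℝ) ≠ 0 := by have := ha ⟨0, hk⟩; positivity
  have h1 := mul_boxMarginal ha p ⟨0, hk⟩ (σ ⟨0, hk⟩ l)
  rw [hm, sum_eq_single (boxVertex a fun i => σ i l), boxVertex_apply, if_pos rfl, mul_comm] at h1
  · rw [permPoint_boxVertex hk ha, ← mul_right_cancel₀ h0 h1]
  · intro y _ hy
    by_cases hy0 : permPoint a σ y = 0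
    · rw [hsupp y hy0, zero_mul]
    obtain ⟨m, rfl⟩ := exists_of_permPoint_ne_zero hy0
    rw [boxVertex_apply, if_neg, Nat.cast_zero, mul_zero]
    intro hlm
    exact hy (by rw [(σ ⟨0, hk⟩).injective hlm])
  · simp

theorem permPoint_mem_extremePoints (hk : 0 < k) (ha : ∀ i, 1 ≤ a i)
    (σ : Fin k → Equiv.Perm (Fin (d + 1))) :
    permPoint a σ ∈
      Set.extremePoints ℝ (fiberPolytope (boxMatrix d a) (boxCentroid d a)) := by
  refine ⟨(mem_fiberPolytope_boxCentroid_iff ha).2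
    ⟨permPoint_mem σ, boxMarginal_permPoint ha σ⟩, ?_⟩
  rintro p hp q hq ⟨s, t, hs, ht, -, hst⟩
  rw [mem_fiberPolytope_boxCentroid_iff ha] at hp hq
  refine eq_permPoint_of_support_subset hk ha hp.2 fun x hx => ?_
  have h1 : s * p x + t * q x = 0 := by rw [← hx, ← hst]; simp
  have h2 := mul_nonneg hs.le (hp.1.1 x)
  have h3 := mul_nonneg ht.le (hq.1.1 x)
  exact (mul_eq_zero.1 (by linarith : s * p x = 0)).resolve_left hs.ne'

/-! ### The maximum, the maximizers and their number -/

theorem maxDivergence_boxModel (hk : 2 ≤ k) (ha : ∀ i, 1 ≤ a i) :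
    maxDivergence (boxModel d a) =
      ((((∑ i, (a i : ℝ)) - 1) * Real.log ((d : ℝ) + 1) : ℝ) : EReal) := by
  refine IsGreatest.csSup_eq ⟨⟨permPoint a 1, permPoint_mem 1, ?_⟩, ?_⟩
  · rw [divergenceTo_boxModel ha (permPoint_mem 1), boxDiv_permPoint (by omega) ha]
  · rintro _ ⟨p, hp, rfl⟩
    rw [divergenceTo_boxModel ha hp, EReal.coe_le_coe_iff]
    exact boxDiv_le hk ha hp

theorem mem_divergenceMaximizers_boxModel_iff (hk : 2 ≤ k) (ha : ∀ i, 1 ≤ a i)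
    {p : BoxState d a → ℝ} :
    p ∈ divergenceMaximizers (boxModel d a) ↔ p ∈ stdSimplex ℝ (BoxState d a) ∧
      boxDiv p = ((∑ i, (a i : ℝ)) - 1) * Real.log ((d : ℝ) + 1) :=
  and_congr_right fun hp => by
    rw [divergenceTo_boxModel ha hp, maxDivergence_boxModel hk ha, EReal.coe_eq_coe_iff]

theorem divergenceMaximizers_boxModel (hk : 2 ≤ k) (ha : ∀ i, 1 ≤ a i) (i₀ : Fin k) :
    divergenceMaximizers (boxModel d a) =
      permPoint a '' {σ : Fin k → Equiv.Perm (Fin (d + 1)) | σ i₀ = 1} := by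
  ext p
  rw [mem_divergenceMaximizers_boxModel_iff hk ha]
  constructor
  · rintro ⟨hp, h⟩
    exact exists_eq_permPoint hk ha hp h i₀
  · rintro ⟨σ, -, rfl⟩
    exact ⟨permPoint_mem σ, boxDiv_permPoint (by omega) ha σ⟩

theorem ncard_setOf_apply_eq {G : Type*} [Fintype G] (i₀ : Fin k) (g : G) :
    {σ : Fin k → G | σ i₀ = g}.ncard = Fintype.card G ^ (k - 1) := by
  obtain ⟨m, rfl⟩ : ∃ m, k = m + 1 := ⟨k - 1, by have := i₀.pos; omega⟩
  have : {σ : Fin (m + 1) → G | σ i₀ = g} = Set.range fun τ : Fin m → G => i₀.insertNth g τ := by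
    ext σ
    constructor
    · rintro rfl
      exact ⟨i₀.removeNth σ, Fin.insertNth_self_removeNth i₀ σ⟩
    · rintro ⟨τ, rfl⟩
      exact Fin.insertNth_apply_same (α := fun _ => G) i₀ g τ
  rw [this, ← Set.image_univ, Set.ncard_image_of_injective _ fun τ τ' h =>
    (Fin.insertNth_inj (α := fun _ => G).1 h).2, Set.ncard_univ, Nat.card_eq_fintype_card]
  simp

end Box

theorem theorem6p4 (d k : ℕ) (hk : 2 ≤ k) (a : Fin k → ℕ) (ha : ∀ i, 1 ≤ a i) :
    -- the minimum in the definition of the divergence to the model is attained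
    (∀ p ∈ stdSimplex ℝ (BoxState d a),
      IsLeast (infoDiv p '' boxModel d a) (divergenceTo (boxModel d a) p)) ∧
    -- the maximum divergence
    maxDivergence (boxModel d a) =
      ((((∑ i, (a i : ℝ)) - 1) * Real.log ((d : ℝ) + 1) : ℝ) : EReal) ∧
    -- the polytope of the centroid is the logarithmic Voronoi cell at a point of the model, and
    -- no logarithmic Voronoi cell at another point of the model contains a maximizer
    (∃ q ∈ boxModel d a,
      (boxMatrix d a).mulVec q = boxCentroid d a ∧
      logVoronoiCell (boxModel d a) q = fiberPolytope (boxMatrix d a) (boxCentroid d a) ∧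
      ∀ q' ∈ boxModel d a,
        (logVoronoiCell (boxModel d a) q' ∩ divergenceMaximizers (boxModel d a)).Nonempty →
          q' = q) ∧
    -- all maximizers are vertices of this polytope, and there are exactly `((d + 1)!) ^ (k - 1)`
    divergenceMaximizers (boxModel d a) ⊆
      Set.extremePoints ℝ (fiberPolytope (boxMatrix d a) (boxCentroid d a)) ∧
    (divergenceMaximizers (boxModel d a)).ncard = (Nat.factorial (d + 1)) ^ (k - 1) := by
  have hs : ∀ _ : Fin k, (fun _ => 1 / ((d : ℝ) + 1)) ∈ stdSimplex ℝ (Fin (d + 1)) :=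
    fun _ => const_mem_stdSimplex d
  have i₀ : Fin k := ⟨0, by omega⟩
  refine ⟨fun p hp => ?_, maxDivergence_boxModel hk ha,
    ⟨boxParam d a fun _ _ => 1 / ((d : ℝ) + 1), ⟨_, hs, rfl⟩, ?_, ?_, ?_⟩, ?_, ?_⟩
  · rw [divergenceTo_boxModel ha hp]
    exact isLeast_boxDiv ha hp
  · exact ((mem_fiberPolytope_boxCentroid_iff ha).2
      ⟨boxParam_mem_stdSimplex hs, boxMarginal_boxParam ha hs⟩).2
  · ext p
    rw [mem_logVoronoiCell_boxParam_iff ha hs, mem_fiberPolytope_boxCentroid_iff ha]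
  · rintro _ ⟨s, hs', rfl⟩ ⟨p, hp, hmax⟩
    rw [mem_logVoronoiCell_boxParam_iff ha hs'] at hp
    rw [mem_divergenceMaximizers_boxModel_iff hk ha] at hmax
    rw [← hp.2, boxMarginal_eq_const_of_boxDiv_eq hk ha hmax.1 hmax.2]
  · rw [divergenceMaximizers_boxModel hk ha i₀]
    rintro _ ⟨σ, -, rfl⟩
    exact permPoint_mem_extremePoints (by omega) ha σ
  · rw [divergenceMaximizers_boxModel hk ha i₀, Set.InjOn.ncard_image, ncard_setOf_apply_eq,
      Fintype.card_perm, Fintype.card_fin]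
    exact fun σ hσ τ hτ => eq_of_permPoint_eq ha (Eq.trans hσ (Eq.symm hτ))
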